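/- Let $n \ge 4$ be an integer that is not prime, and let $\Gamma(\mathbb{Z}_n)$ be the zero divisor graph of the ring $\mathbb{Z}_n$ of integers modulo $n$: its vertices are the nonzero $x \in \mathbb{Z}_n$ for which $xy = 0$ for some nonzero $y \in \mathbb{Z}_n$, and two distinct vertices $x, y$ are adjacent if and only if $xy = 0$. For a finite simple graph $G$ with at least two vertices, let the algebraic connectivity $\mu(G)$ be the second smallest eigenvalue, counted with multiplicity, of the Laplacian matrix $L(G) = D(G) - A(G)$, where $D(G)$ is the diagonal matrix of vertex degrees and $A(G)$ is the adjacency matrix; $\mu(G)$ is undefined if $G$ has only one vertex. Let the vertex connectivity $\kappa(G)$ be the minimum number of vertices whose removal leaves an induced subgraph that is disconnected or has exactly one vertex. Then $\mu(\Gamma(\mathbb{Z}_n))$ is defined (that is, $\Gamma(\mathbb{Z}_n)$ has at least two vertices) and $$\mu(\Gamma(\mathbb{Z}_n)) = \kappa(\Gamma(\mathbb{Z}_n))$$ if and only if $n = pq$ for two distinct primes $p$ and $q$, or $n = p^t$ for some prime $p$ and some integer $t \ge 3$. -/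

import Mathlib

/-- The (nonzero) zero divisors of a commutative ring: the nonzero `x` for which there is a
nonzero `y` with `x * y = 0`. -/
abbrev ZeroDivisor (R : Type*) [CommRing R] : Type _ :=
  {x : R // x ≠ 0 ∧ ∃ y : R, y ≠ 0 ∧ x * y = 0}

noncomputable instance ZeroDivisor.instFintype (R : Type*) [CommRing R] [Finite R] :
    Fintype (ZeroDivisor R) := Fintype.ofFinite _

/-- The zero divisor graph of a commutative ring: its vertices are the nonzero zero divisors, and
two distinct vertices are adjacent iff their product is zero. -/
def zeroDivisorGraph (R : Type*) [CommRing R] : SimpleGraph (ZeroDivisor R) where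
  Adj x y := x ≠ y ∧ (x : R) * (y : R) = 0
  symm := ⟨fun _ _ h => ⟨h.1.symm, by rw [mul_comm]; exact h.2⟩⟩
  loopless := ⟨fun _ h => h.1 rfl⟩

namespace SimpleGraph

open Classical in
/-- The algebraic connectivity of a finite graph with at least two vertices: the second smallest
eigenvalue, counted with multiplicity, of its Laplacian matrix. (`eigenvalues₀` lists the
eigenvalues with multiplicity in decreasing order, so the second smallest one stands at
position `card V - 2`.) A graph with at most one vertex has no second smallest eigenvalue. -/
noncomputable def algebraicConnectivity {V : Type*} [Fintype V] (G : SimpleGraph V)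
    (h : 2 ≤ Fintype.card V) : ℝ :=
  (G.isHermitian_lapMatrix ℝ).eigenvalues₀ ⟨Fintype.card V - 2, by omega⟩

/-- The vertex connectivity of a finite graph: the least number of vertices whose removal leaves
an induced subgraph that is disconnected or has exactly one vertex. (A graph without vertices is
`Preconnected`, so it does not count as disconnected.) -/
noncomputable def vertexConnectivity {V : Type*} [Fintype V] (G : SimpleGraph V) : ℕ :=
  sInf {k : ℕ | ∃ S : Finset V, S.card = k ∧
    (¬ (G.induce {v | v ∉ S}).Preconnected ∨ Nat.card {v // v ∉ S} = 1)}

end SimpleGraph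

/-!
By Courant–Fischer, `μ(G)` is the minimum of the Rayleigh quotient of the Laplacian over nonzero
vectors orthogonal to `1`. Testing it on a vector that vanishes on a vertex cut `S` and is constant
on the two sides of the cut yields `μ(G) ≤ κ(G)` for `G` not complete, and equality forces a minimum
cut to be joined to all other vertices, so that the complement of `G` is disconnected (unless `G`
is). Conversely, if a cut `S` with at most half of the vertices is joined to all other vertices,
then the edges at the cut alone bound the Rayleigh quotient below by `|S|`, and `μ(G) = κ(G) = |S|`.

If two distinct primes `p, q` divide `n` and `n ≠ pq`, the complement of `Γ(ℤ_n)` is connected: no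
vertex is annihilated by both `p` and `q`, and `pq ≠ 0`. If `n = p²`, the graph is complete, so
`κ < |V| = μ` (or `μ` is undefined, for `n = 4`). In the remaining cases the annihilator of `p` (the
smaller prime if `n = pq`) is a cut of the required kind, isolating the vertex `p`.
-/

open Finset Matrix Module
open scoped InnerProductSpace

section CourantFischer

variable {𝕜 E : Type*} [RCLike 𝕜] [NormedAddCommGroup E] [InnerProductSpace 𝕜 E]

theorem finrank_span_pair_of_inner_eq_zero {x y : E} (hx : x ≠ 0) (hy : y ≠ 0)
    (hxy : ⟪x, y⟫_𝕜 = 0) : finrank 𝕜 (Submodule.span 𝕜 {x, y}) = 2 := by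
  have hli : LinearIndependent 𝕜 ![x, y] :=
    linearIndependent_of_ne_zero_of_inner_eq_zero (by simp [Fin.forall_fin_two, hx, hy])
      (by simp [Pairwise, Fin.forall_fin_two, hxy, inner_eq_zero_symm.1 hxy])
  rw [← Fintype.card_fin 2, ← finrank_span_eq_card hli, Matrix.range_cons_cons_empty]

theorem exists_mem_ne_zero_forall_inner_eq_zero {ι : Type*} [Fintype ι] (v : ι → E)
    {U : Submodule 𝕜 E} [FiniteDimensional 𝕜 U] (hU : Fintype.card ι < finrank 𝕜 U) :
    ∃ x ∈ U, x ≠ 0 ∧ ∀ i, ⟪v i, x⟫_𝕜 = 0 := by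
  let f : U →ₗ[𝕜] ι → 𝕜 := LinearMap.pi fun i => innerₛₗ 𝕜 (v i) ∘ₗ U.subtype
  have hf : LinearMap.ker f ≠ ⊥ := LinearMap.ker_ne_bot_of_finrank_lt (by simpa using hU)
  obtain ⟨x, hx, hx0⟩ := Submodule.exists_mem_ne_zero_of_ne_bot hf
  exact ⟨x, x.2, by simpa using hx0, fun i => congrFun hx i⟩

variable [FiniteDimensional 𝕜 E] {n : ℕ} {T : E →ₗ[𝕜] E}

theorem re_inner_apply_self_eq_sum_eigenvalues (hT : T.IsSymmetric) (hn : finrank 𝕜 E = n)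
    (x : E) : RCLike.re ⟪T x, x⟫_𝕜 =
      ∑ i, hT.eigenvalues hn i * ‖⟪hT.eigenvectorBasis hn i, x⟫_𝕜‖ ^ 2 := by
  rw [← (hT.eigenvectorBasis hn).sum_inner_mul_inner, map_sum]
  refine sum_congr rfl fun i _ => ?_
  rw [hT x, hT.apply_eigenvectorBasis, inner_smul_right, mul_assoc, RCLike.re_ofReal_mul,
    ← inner_conj_symm, RCLike.conj_mul, ← RCLike.ofReal_pow, RCLike.ofReal_re]

theorem eigenvalues_le_of_forall_mem (hT : T.IsSymmetric) (hn : finrank 𝕜 E = n) (i : Fin n)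
    {U : Submodule 𝕜 E} {c : ℝ} (hU : n ≤ finrank 𝕜 U + i)
    (hc : ∀ x ∈ U, RCLike.re ⟪T x, x⟫_𝕜 ≤ c * ‖x‖ ^ 2) : hT.eigenvalues hn i ≤ c := by
  set b := hT.eigenvectorBasis hn
  obtain ⟨x, hxU, hx0, hx⟩ := exists_mem_ne_zero_forall_inner_eq_zero
    (fun j : Ioi i => b j) (U := U) (by rw [Fintype.card_coe, Fin.card_Ioi]; lia)
  refine le_of_mul_le_mul_right ?_ (pow_pos (norm_pos_iff.2 hx0) 2)
  calc hT.eigenvalues hn i * ‖x‖ ^ 2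
      = ∑ j, hT.eigenvalues hn i * ‖⟪b j, x⟫_𝕜‖ ^ 2 := by rw [← mul_sum, b.sum_sq_norm_inner_right]
    _ ≤ ∑ j, hT.eigenvalues hn j * ‖⟪b j, x⟫_𝕜‖ ^ 2 := sum_le_sum fun j _ => by
        rcases le_or_gt j i with hji | hij
        · gcongr
          exact hT.eigenvalues_antitone hn hji
        · simp [hx ⟨j, mem_Ioi.2 hij⟩]
    _ = RCLike.re ⟪T x, x⟫_𝕜 := (re_inner_apply_self_eq_sum_eigenvalues hT hn x).symm
    _ ≤ c * ‖x‖ ^ 2 := hc x hxU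

theorem le_eigenvalues_of_forall_mem (hT : T.IsSymmetric) (hn : finrank 𝕜 E = n) (i : Fin n)
    {U : Submodule 𝕜 E} {c : ℝ} (hU : i < finrank 𝕜 U)
    (hc : ∀ x ∈ U, c * ‖x‖ ^ 2 ≤ RCLike.re ⟪T x, x⟫_𝕜) : c ≤ hT.eigenvalues hn i := by
  set b := hT.eigenvectorBasis hn
  obtain ⟨x, hxU, hx0, hx⟩ := exists_mem_ne_zero_forall_inner_eq_zero
    (fun j : Iio i => b j) (U := U) (by rwa [Fintype.card_coe, Fin.card_Iio])
  refine le_of_mul_le_mul_right ?_ (pow_pos (norm_pos_iff.2 hx0) 2)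
  calc c * ‖x‖ ^ 2 ≤ RCLike.re ⟪T x, x⟫_𝕜 := hc x hxU
    _ = ∑ j, hT.eigenvalues hn j * ‖⟪b j, x⟫_𝕜‖ ^ 2 :=
        re_inner_apply_self_eq_sum_eigenvalues hT hn x
    _ ≤ ∑ j, hT.eigenvalues hn i * ‖⟪b j, x⟫_𝕜‖ ^ 2 := sum_le_sum fun j _ => by
        rcases lt_or_ge j i with hji | hij
        · simp [hx ⟨j, mem_Iio.2 hji⟩]
        · gcongr
          exact hT.eigenvalues_antitone hn hij
    _ = hT.eigenvalues hn i * ‖x‖ ^ 2 := by rw [← mul_sum, b.sum_sq_norm_inner_right]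

end CourantFischer

section AlgebraicConnectivity

variable {V : Type*} [Fintype V] {G : SimpleGraph V}

theorem real_inner_toEuclideanLin_self [DecidableEq V] (A : Matrix V V ℝ)
    (x : EuclideanSpace ℝ V) : ⟪toEuclideanLin A x, x⟫_ℝ = x.ofLp ⬝ᵥ A *ᵥ x.ofLp := by
  simp [EuclideanSpace.inner_eq_star_dotProduct]

theorem lapMatrix_quadraticForm_const_add_smul [DecidableEq V] [DecidableRel G.Adj] (a b : ℝ)
    (x : V → ℝ) : (a • 1 + b • x) ⬝ᵥ G.lapMatrix ℝ *ᵥ (a • 1 + b • x) =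
      b ^ 2 * (x ⬝ᵥ G.lapMatrix ℝ *ᵥ x) := by
  have hone : G.lapMatrix ℝ *ᵥ 1 = 0 := G.lapMatrix_mulVec_const_eq_zero (R := ℝ)
  have hone' : (1 : V → ℝ) ⬝ᵥ G.lapMatrix ℝ *ᵥ x = 0 := by
    rw [dotProduct_mulVec, ← mulVec_transpose, (G.isSymm_lapMatrix (R := ℝ)).eq, hone,
      zero_dotProduct]
  simp only [mulVec_add, mulVec_smul, hone, smul_zero, zero_add, add_dotProduct, smul_dotProduct,
    dotProduct_smul, hone', smul_eq_mul, mul_zero]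
  ring

open Classical in
theorem algebraicConnectivity_mul_le (h : 2 ≤ Fintype.card V) {x : V → ℝ} (hx : ∑ v, x v = 0) :
    G.algebraicConnectivity h * ∑ v, x v ^ 2 ≤ x ⬝ᵥ G.lapMatrix ℝ *ᵥ x := by
  rcases eq_or_ne x 0 with rfl | hx0
  · simp
  have : Nonempty V := Fintype.card_pos_iff.1 (by lia)
  set q := x ⬝ᵥ G.lapMatrix ℝ *ᵥ x
  have hq : 0 ≤ q := by simpa using (G.posSemidef_lapMatrix ℝ).dotProduct_mulVec_nonneg x
  have hnorm : 0 < ∑ v, x v ^ 2 := by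
    obtain ⟨v, hv⟩ := Function.ne_iff.1 hx0
    exact sum_pos' (fun v _ => sq_nonneg _) ⟨v, mem_univ v, sq_pos_of_ne_zero hv⟩
  rw [← le_div_iff₀ hnorm]
  let U := Submodule.span ℝ {WithLp.toLp 2 (1 : V → ℝ), WithLp.toLp 2 x}
  have hU : finrank ℝ U = 2 := finrank_span_pair_of_inner_eq_zero (by simp) (by simpa using hx0)
    (by simpa [EuclideanSpace.inner_eq_star_dotProduct, dotProduct] using hx)
  refine eigenvalues_le_of_forall_mem _ _ _ (U := U) (by simp [hU]; lia) fun y hy => ?_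
  obtain ⟨a, b, rfl⟩ := Submodule.mem_span_pair.1 hy
  have hsq : ∑ v, (a + b * x v) ^ 2 = a ^ 2 * Fintype.card V + b ^ 2 * ∑ v, x v ^ 2 := by
    simp only [add_sq, sum_add_distrib, mul_pow, ← mul_sum, ← mul_assoc, hx]
    simp [mul_comm]
  rw [RCLike.re_to_real, real_inner_toEuclideanLin_self, EuclideanSpace.real_norm_sq_eq]
  calc (a • 1 + b • x) ⬝ᵥ G.lapMatrix ℝ *ᵥ (a • 1 + b • x)
      = q / (∑ v, x v ^ 2) * (b ^ 2 * ∑ v, x v ^ 2) := by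
        rw [lapMatrix_quadraticForm_const_add_smul, mul_left_comm, div_mul_cancel₀ q hnorm.ne']
    _ ≤ q / (∑ v, x v ^ 2) * ∑ v, (a + b * x v) ^ 2 := by
        rw [hsq]
        gcongr
        exact le_add_of_nonneg_left (by positivity)
    _ = _ := by simp

open Classical in
theorem le_algebraicConnectivity (h : 2 ≤ Fintype.card V) {c : ℝ}
    (hc : ∀ x : V → ℝ, ∑ v, x v = 0 → c * ∑ v, x v ^ 2 ≤ x ⬝ᵥ G.lapMatrix ℝ *ᵥ x) :
    c ≤ G.algebraicConnectivity h := by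
  have : Nonempty V := Fintype.card_pos_iff.1 (by lia)
  let U := ℝ ∙ WithLp.toLp 2 (1 : V → ℝ)
  have hU : 1 + finrank ℝ Uᗮ = Fintype.card V := by
    rw [← finrank_euclideanSpace (𝕜 := ℝ), ← U.finrank_add_finrank_orthogonal,
      finrank_span_singleton (by simp)]
  refine le_eigenvalues_of_forall_mem _ _ _ (U := Uᗮ) (show _ - 2 < _ by lia) fun x hx => ?_
  rw [RCLike.re_to_real, real_inner_toEuclideanLin_self, EuclideanSpace.real_norm_sq_eq]
  rw [Submodule.mem_orthogonal_singleton_iff_inner_left] at hx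
  exact hc x (by simpa [EuclideanSpace.inner_eq_star_dotProduct, dotProduct] using hx)

end AlgebraicConnectivity

section Cut

variable {V : Type*} {G : SimpleGraph V}

theorem not_preconnected_induce_of_isolated {S : Finset V} {v w : V} (hv : v ∉ S) (hw : w ∉ S)
    (hvw : v ≠ w) (h : ∀ u, G.Adj v u → u ∈ S) :
    ¬ (G.induce {u | u ∉ S}).Preconnected := fun hG =>
  have : Nontrivial {u | u ∉ S} := ⟨⟨v, hv⟩, ⟨w, hw⟩, by simpa using hvw⟩
  hG.not_isIsolated ⟨v, hv⟩ fun u hu => u.2 (h u hu)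

open Classical in
theorem exists_sum_eq_zero_of_not_preconnected [Fintype V] (hG : ¬ G.Preconnected) :
    ∃ x : V → ℝ, ∑ v, x v = 0 ∧ (∀ v, x v ≠ 0) ∧ ∀ v w, G.Adj v w → x v = x w := by
  simp only [SimpleGraph.Preconnected, not_forall] at hG
  obtain ⟨a, b, hab⟩ := hG
  let A : Finset V := {v | G.Reachable a v}
  have ha : a ∈ A := by simp [A]
  have hb : b ∈ Aᶜ := by simpa [A] using hab
  refine ⟨fun v => if v ∈ A then #Aᶜ else -#A, ?_, fun v => ?_, fun v w hvw => ?_⟩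
  · rw [sum_ite, filter_mem_eq_inter, filter_notMem_eq_sdiff, univ_inter, ← compl_eq_univ_sdiff]
    simp [mul_comm]
  · dsimp only
    split_ifs
    · exact_mod_cast card_ne_zero_of_mem hb
    · exact neg_ne_zero.2 (by exact_mod_cast card_ne_zero_of_mem ha)
  · have : v ∈ A ↔ w ∈ A := by
      simpa [A] using ⟨fun h => h.trans hvw.reachable, fun h => h.trans hvw.symm.reachable⟩
    simp only [this]

variable [Fintype V] {S : Finset V}

theorem exists_support_eq_compl_of_not_preconnected_induce
    (hS : ¬ (G.induce {v | v ∉ S}).Preconnected) :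
    ∃ x : V → ℝ, ∑ v, x v = 0 ∧ (∀ v, x v = 0 ↔ v ∈ S) ∧
      ∀ v w, v ∉ S → w ∉ S → G.Adj v w → x v = x w := by
  classical
  obtain ⟨y, hsum, hy0, hy⟩ := exists_sum_eq_zero_of_not_preconnected hS
  let x : V → ℝ := fun v => if hv : v ∈ S then 0 else y ⟨v, hv⟩
  have hx : ∑ v, x v = ∑ v, y v :=
    (Fintype.sum_of_injective _ Subtype.val_injective y x
      (fun v hv => dif_pos (by simpa using hv)) fun v => by simp [x, show v.1 ∉ S from v.2]).symm
  refine ⟨x, hx.trans hsum, fun v => ?_, fun v w hv hw hvw => ?_⟩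
  · by_cases hv : v ∈ S <;> simp [x, hv, hy0]
  · simpa [x, hv, hw] using hy ⟨v, hv⟩ ⟨w, hw⟩ hvw

open Classical in
theorem lapMatrix_quadraticForm_eq_sum_card_mul_sq {x : V → ℝ} (hx0 : ∀ v ∈ S, x v = 0)
    (hx : ∀ v w, v ∉ S → w ∉ S → G.Adj v w → x v = x w) :
    x ⬝ᵥ G.lapMatrix ℝ *ᵥ x = ∑ v, (#{u ∈ S | G.Adj v u} : ℝ) * x v ^ 2 := by
  refine sum_congr rfl fun v _ => ?_
  by_cases hv : v ∈ S
  · simp [hx0 v hv]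
  have hsum : ∑ u ∈ G.neighborFinset v, (x v - x u) = #{u ∈ S | G.Adj v u} * x v := by
    calc ∑ u ∈ G.neighborFinset v, (x v - x u)
        = ∑ u ∈ G.neighborFinset v, if u ∈ S then x v else 0 := sum_congr rfl fun u hu => by
          split_ifs with huS
          · rw [hx0 u huS, sub_zero]
          · rw [hx v u hv huS (by simpa using hu), sub_self]
      _ = #{u ∈ S | G.Adj v u} * x v := by
          rw [← sum_filter, sum_const, nsmul_eq_mul]
          congr 3
          ext u
          simp [and_comm]
  rw [sum_sub_distrib, sum_const, SimpleGraph.card_neighborFinset_eq_degree, nsmul_eq_mul] at hsum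
  rw [SimpleGraph.lapMatrix_mulVec_apply, hsum]
  ring

open Classical in
theorem exists_algebraicConnectivity_mul_le_sum (h : 2 ≤ Fintype.card V)
    (hS : ¬ (G.induce {v | v ∉ S}).Preconnected) :
    ∃ x : V → ℝ, (∀ v, x v = 0 ↔ v ∈ S) ∧
      G.algebraicConnectivity h * ∑ v, x v ^ 2 ≤ ∑ v, (#{u ∈ S | G.Adj v u} : ℝ) * x v ^ 2 := by
  obtain ⟨x, hsum, hx0, hx⟩ := exists_support_eq_compl_of_not_preconnected_induce hS
  refine ⟨x, hx0, ?_⟩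
  rw [← lapMatrix_quadraticForm_eq_sum_card_mul_sq (fun v => (hx0 v).2) hx]
  exact algebraicConnectivity_mul_le h hsum

theorem algebraicConnectivity_le_card (h : 2 ≤ Fintype.card V)
    (hS : ¬ (G.induce {v | v ∉ S}).Preconnected) : G.algebraicConnectivity h ≤ #S := by
  classical
  obtain ⟨x, hx0, hx⟩ := exists_algebraicConnectivity_mul_le_sum h hS
  obtain ⟨v, hv⟩ : ∃ v, v ∉ S := by
    by_contra! hv
    exact hS fun v => (v.2 (hv v)).elim
  refine le_of_mul_le_mul_right (hx.trans ?_)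
    (sum_pos' (fun v _ => sq_nonneg (x v)) ⟨v, mem_univ v, sq_pos_of_ne_zero (mt (hx0 v).1 hv)⟩)
  rw [mul_sum]
  gcongr
  exact filter_subset _ _

theorem adj_of_algebraicConnectivity_eq_card {h : 2 ≤ Fintype.card V}
    (hS : ¬ (G.induce {v | v ∉ S}).Preconnected) (hμ : G.algebraicConnectivity h = #S)
    {v w : V} (hv : v ∉ S) (hw : w ∈ S) : G.Adj v w := by
  classical
  obtain ⟨x, hx0, hx⟩ := exists_algebraicConnectivity_mul_le_sum h hS
  rw [hμ, mul_sum] at hx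
  have hle : ∀ u ∈ univ, (#{u' ∈ S | G.Adj u u'} : ℝ) * x u ^ 2 ≤ #S * x u ^ 2 := fun u _ => by
    gcongr
    exact filter_subset _ _
  have heq := (sum_eq_sum_iff_of_le hle).1 (le_antisymm (sum_le_sum hle) hx) v (mem_univ v)
  have hcard : #{u ∈ S | G.Adj v u} = #S := by
    exact_mod_cast mul_right_cancel₀ (pow_ne_zero 2 (mt (hx0 v).1 hv)) heq
  exact filter_card_eq hcard w hw

end Cut

section Join

variable {V : Type*} [Fintype V] {G : SimpleGraph V} {S : Finset V}

theorem sum_sum_sub_sq {ι R : Type*} [CommRing R] (s t : Finset ι) (f : ι → R) :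
    ∑ i ∈ s, ∑ j ∈ t, (f i - f j) ^ 2 =
      #t * ∑ i ∈ s, f i ^ 2 + #s * ∑ j ∈ t, f j ^ 2 - 2 * ((∑ i ∈ s, f i) * ∑ j ∈ t, f j) := by
  simp only [sub_sq, sum_add_distrib, sum_sub_distrib, sum_const, nsmul_eq_mul, ← mul_sum,
    ← sum_mul, mul_assoc]
  ring

theorem sum_sum_sub_sq_le_lapMatrix_quadraticForm [DecidableEq V] [DecidableRel G.Adj]
    (hjoin : ∀ v ∉ S, ∀ w ∈ S, G.Adj v w) (x : V → ℝ) :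
    ∑ v ∈ S, ∑ w ∈ Sᶜ, (x v - x w) ^ 2 ≤ x ⬝ᵥ G.lapMatrix ℝ *ᵥ x := by
  let f : V → V → ℝ := fun v w => if G.Adj v w then (x v - x w) ^ 2 else 0
  have hST : ∑ v ∈ S, ∑ w ∈ Sᶜ, f v w = ∑ v ∈ S, ∑ w ∈ Sᶜ, (x v - x w) ^ 2 :=
    sum_congr rfl fun v hv => sum_congr rfl fun w hw =>
      if_pos (hjoin w (mem_compl.1 hw) v hv).symm
  have hTS : ∑ v ∈ Sᶜ, ∑ w ∈ S, f v w = ∑ v ∈ S, ∑ w ∈ Sᶜ, (x v - x w) ^ 2 := by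
    rw [sum_comm]
    exact sum_congr rfl fun v hv => sum_congr rfl fun w hw =>
      (if_pos (hjoin w (mem_compl.1 hw) v hv)).trans (sub_sq_comm _ _)
  have hle : ∑ v ∈ S, ∑ w ∈ Sᶜ, f v w + ∑ v ∈ Sᶜ, ∑ w ∈ S, f v w ≤ ∑ v, ∑ w, f v w := by
    have hf : ∀ v w, 0 ≤ f v w := fun v w => by positivity
    rw [← sum_add_sum_compl S]
    exact add_le_add
      (sum_le_sum fun v _ => sum_le_univ_sum_of_nonneg (hf v))
      (sum_le_sum fun v _ => sum_le_univ_sum_of_nonneg (hf v))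
  rw [← toLinearMap₂'_apply', SimpleGraph.lapMatrix_toLinearMap₂']
  linarith

theorem card_le_algebraicConnectivity (h : 2 ≤ Fintype.card V) (hS : 2 * #S ≤ Fintype.card V)
    (hjoin : ∀ v ∉ S, ∀ w ∈ S, G.Adj v w) : #S ≤ G.algebraicConnectivity h := by
  classical
  refine le_algebraicConnectivity h fun x hx => ?_
  have hcard : (#S : ℝ) ≤ #Sᶜ := by
    rw [card_compl]
    exact_mod_cast (by lia : #S ≤ Fintype.card V - #S)
  have hsum : ∑ w ∈ Sᶜ, x w = -∑ v ∈ S, x v := by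
    rw [← sum_add_sum_compl S] at hx
    linarith
  calc #S * ∑ v, x v ^ 2 = #S * ∑ v ∈ S, x v ^ 2 + #S * ∑ w ∈ Sᶜ, x w ^ 2 := by
        rw [← mul_add, sum_add_sum_compl]
    _ ≤ #Sᶜ * ∑ v ∈ S, x v ^ 2 + #S * ∑ w ∈ Sᶜ, x w ^ 2 := by gcongr
    _ ≤ ∑ v ∈ S, ∑ w ∈ Sᶜ, (x v - x w) ^ 2 := by
        rw [sum_sum_sub_sq, hsum]
        nlinarith [sq_nonneg (∑ v ∈ S, x v)]
    _ ≤ _ := sum_sum_sub_sq_le_lapMatrix_quadraticForm hjoin x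

theorem card_le_algebraicConnectivity_top (h : 2 ≤ Fintype.card V) :
    Fintype.card V ≤ (⊤ : SimpleGraph V).algebraicConnectivity h := by
  classical
  refine le_algebraicConnectivity h fun x hx => le_of_eq ?_
  calc Fintype.card V * ∑ v, x v ^ 2 = (∑ v, ∑ w, (x v - x w) ^ 2) / 2 := by
        rw [sum_sum_sub_sq, hx, card_univ]
        ring
    _ = _ := by
        rw [← toLinearMap₂'_apply', SimpleGraph.lapMatrix_toLinearMap₂']
        congr! 3 with v _ w _
        rcases eq_or_ne v w with rfl | hvw <;> simp [*]

end Join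

section VertexConnectivity

variable {V : Type*} {G : SimpleGraph V} {S : Finset V}

theorem ne_top_of_not_preconnected_induce (hS : ¬ (G.induce {v | v ∉ S}).Preconnected) :
    G ≠ ⊤ := by
  rintro rfl
  exact hS (by simp)

variable [Fintype V]

theorem vertexConnectivity_le_card (hS : ¬ (G.induce {v | v ∉ S}).Preconnected) :
    G.vertexConnectivity ≤ #S :=
  Nat.sInf_le ⟨S, rfl, .inl hS⟩

theorem vertexConnectivity_lt_card [Nonempty V] : G.vertexConnectivity < Fintype.card V := by
  classical
  obtain ⟨v⟩ := ‹Nonempty V›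
  refine lt_of_le_of_lt (Nat.sInf_le ⟨univ.erase v, rfl, .inr ?_⟩)
    (card_erase_lt_of_mem (mem_univ v))
  rw [Nat.subtype_card {v} (by simp), card_singleton]

theorem exists_card_eq_vertexConnectivity (hG : G ≠ ⊤) :
    ∃ S : Finset V, #S = G.vertexConnectivity ∧ ¬ (G.induce {v | v ∉ S}).Preconnected := by
  classical
  obtain ⟨v, w, hvw, hadj⟩ := SimpleGraph.ne_top_iff_exists_not_adj.1 hG
  have hcut : ¬ (G.induce {u | u ∉ ({v, w}ᶜ : Finset V)}).Preconnected :=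
    not_preconnected_induce_of_isolated (v := v) (w := w) (by simp) (by simp) hvw fun u hu => by
      simpa using ⟨hu.ne', fun h => hadj (h ▸ hu)⟩
  have hκ : G.vertexConnectivity ≤ #{v, w}ᶜ := vertexConnectivity_le_card hcut
  obtain ⟨S, hSκ, hS | hS⟩ : G.vertexConnectivity ∈ {k | _} := Nat.sInf_mem ⟨_, _, rfl, .inl hcut⟩
  · exact ⟨S, hSκ, hS⟩
  · rw [Nat.subtype_card Sᶜ (by simp), card_compl] at hS
    rw [← hSκ, card_compl, card_pair hvw] at hκ
    have := Fintype.one_lt_card_iff.2 ⟨v, w, hvw⟩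
    lia

theorem algebraicConnectivity_le_vertexConnectivity (h : 2 ≤ Fintype.card V) (hG : G ≠ ⊤) :
    G.algebraicConnectivity h ≤ G.vertexConnectivity := by
  obtain ⟨S, hSκ, hS⟩ := exists_card_eq_vertexConnectivity hG
  exact hSκ ▸ algebraicConnectivity_le_card h hS

/-- The algebraic connectivity `μ(G)` is defined and equal to the vertex connectivity `κ(G)`. -/
def HasEqualConnectivities (G : SimpleGraph V) : Prop :=
  ∃ h : 2 ≤ Fintype.card V, G.algebraicConnectivity h = G.vertexConnectivity

theorem hasEqualConnectivities_of_join (hS : ¬ (G.induce {v | v ∉ S}).Preconnected)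
    (hcard : 2 * #S ≤ Fintype.card V) (hjoin : ∀ v ∉ S, ∀ w ∈ S, G.Adj v w) :
    HasEqualConnectivities G := by
  have hV : Nontrivial V := by
    contrapose! hS
    exact .of_subsingleton
  have h := Fintype.one_lt_card_iff_nontrivial.2 hV
  exact ⟨h, (algebraicConnectivity_le_vertexConnectivity h
    (ne_top_of_not_preconnected_induce hS)).antisymm
    ((Nat.cast_le.2 (vertexConnectivity_le_card hS)).trans
      (card_le_algebraicConnectivity h hcard hjoin))⟩

theorem not_hasEqualConnectivities_top : ¬ HasEqualConnectivities (⊤ : SimpleGraph V) := by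
  rintro ⟨h, heq⟩
  have : Nonempty V := Fintype.card_pos_iff.1 (by lia)
  exact ((Nat.cast_lt.2 vertexConnectivity_lt_card).trans_le
    (card_le_algebraicConnectivity_top h)).ne' heq

theorem not_hasEqualConnectivities_of_preconnected_compl (hG : G.Preconnected)
    (hGc : Gᶜ.Preconnected) : ¬ HasEqualConnectivities G := by
  rintro ⟨h, heq⟩
  have hnt : Nontrivial V := Fintype.one_lt_card_iff_nontrivial.1 h
  have hne : G ≠ ⊤ := by
    rintro rfl
    exact SimpleGraph.not_preconnected_bot (by simpa using hGc)
  obtain ⟨S, hSκ, hS⟩ := exists_card_eq_vertexConnectivity hne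
  have hjoin : ∀ v ∉ S, ∀ w ∈ S, G.Adj v w := fun v hv w hw =>
    adj_of_algebraicConnectivity_eq_card hS (heq.trans (by rw [hSκ])) hv hw
  obtain ⟨w, hw⟩ : S.Nonempty := by
    rw [nonempty_iff_ne_empty]
    rintro rfl
    have huniv : {v : V | v ∉ (∅ : Finset V)} = Set.univ := by simp
    exact hS (huniv ▸ (SimpleGraph.induceUnivIso G).preconnected_iff.2 hG)
  obtain ⟨v, hv⟩ : ∃ v, v ∉ S := by
    by_contra! hv
    exact hS fun v => (v.2 (hv v)).elim
  obtain ⟨p⟩ := hGc v w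
  obtain ⟨d, -, hd, hd'⟩ := p.exists_boundary_dart {v | v ∉ S} hv (by simpa using hw)
  exact (G.compl_adj d.fst d.snd).1 d.adj |>.2 (hjoin _ hd _ (by simpa using hd'))

end VertexConnectivity

section ZeroDivisorGraph

variable {R : Type*} [CommRing R]

theorem exists_zeroDivisor_mul_eq_zero (x : ZeroDivisor R) : ∃ y : ZeroDivisor R, (x : R) * y = 0 :=
  have ⟨hx, y, hy, hxy⟩ := x.2
  ⟨⟨y, hy, x, hx, by rw [mul_comm, hxy]⟩, hxy⟩

theorem zeroDivisorGraph_reachable_of_mul_eq_zero {x y : ZeroDivisor R} (h : (x : R) * y = 0) :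
    (zeroDivisorGraph R).Reachable x y := by
  rcases eq_or_ne x y with rfl | hxy
  · rfl
  · exact SimpleGraph.Adj.reachable ⟨hxy, h⟩

theorem zeroDivisorGraph_compl_reachable_of_mul_ne_zero {x y : ZeroDivisor R}
    (h : (x : R) * y ≠ 0) : (zeroDivisorGraph R)ᶜ.Reachable x y := by
  rcases eq_or_ne x y with rfl | hxy
  · rfl
  · exact SimpleGraph.Adj.reachable ⟨hxy, fun hadj => h hadj.2⟩

theorem zeroDivisorGraph_preconnected : (zeroDivisorGraph R).Preconnected := by
  intro x y
  obtain ⟨a, hxa⟩ := exists_zeroDivisor_mul_eq_zero x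
  obtain ⟨b, hyb⟩ := exists_zeroDivisor_mul_eq_zero y
  have hxa' := zeroDivisorGraph_reachable_of_mul_eq_zero hxa
  have hyb' := zeroDivisorGraph_reachable_of_mul_eq_zero hyb
  by_cases hab : (a : R) * b = 0
  · exact hxa'.trans ((zeroDivisorGraph_reachable_of_mul_eq_zero hab).trans hyb'.symm)
  · have hxc : (x : R) * (a * b) = 0 := by rw [← mul_assoc, hxa, zero_mul]
    have hyc : (y : R) * (a * b) = 0 := by rw [mul_left_comm, hyb, mul_zero]
    let c : ZeroDivisor R := ⟨a * b, hab, x, x.2.1, by rw [mul_comm, hxc]⟩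
    exact (zeroDivisorGraph_reachable_of_mul_eq_zero (y := c) hxc).trans
      (zeroDivisorGraph_reachable_of_mul_eq_zero (y := c) hyc).symm

theorem eq_zero_of_isCoprime_of_mul_eq_zero {a b x : R} (hab : IsCoprime a b) (ha : a * x = 0)
    (hb : b * x = 0) : x = 0 := by
  obtain ⟨u, v, huv⟩ := hab
  linear_combination (-x) * huv + u * ha + v * hb

theorem zeroDivisorGraph_compl_preconnected {a b : ZeroDivisor R} (hab : IsCoprime (a : R) b)
    (hmul : (a : R) * b ≠ 0) : (zeroDivisorGraph R)ᶜ.Preconnected := by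
  have hreach : ∀ x, (zeroDivisorGraph R)ᶜ.Reachable a x := fun x => by
    by_cases hax : (a : R) * x = 0
    · exact (zeroDivisorGraph_compl_reachable_of_mul_ne_zero hmul).trans
        (zeroDivisorGraph_compl_reachable_of_mul_ne_zero fun hbx =>
          x.2.1 (eq_zero_of_isCoprime_of_mul_eq_zero hab hax hbx))
    · exact zeroDivisorGraph_compl_reachable_of_mul_ne_zero hax
  exact fun x y => (hreach x).symm.trans (hreach y)

theorem zeroDivisorGraph_eq_top (h : ∀ x y : ZeroDivisor R, (x : R) * y = 0) :
    zeroDivisorGraph R = ⊤ := by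
  ext x y
  exact ⟨fun hxy => hxy.1, fun hxy => ⟨hxy, h x y⟩⟩

variable [Finite R]

theorem not_hasEqualConnectivities_zeroDivisorGraph_of_isCoprime {a b : ZeroDivisor R}
    (hab : IsCoprime (a : R) b) (hmul : (a : R) * b ≠ 0) :
    ¬ HasEqualConnectivities (zeroDivisorGraph R) :=
  not_hasEqualConnectivities_of_preconnected_compl zeroDivisorGraph_preconnected
    (zeroDivisorGraph_compl_preconnected hab hmul)

open Classical in
theorem hasEqualConnectivities_zeroDivisorGraph_of_card_lt {a : ZeroDivisor R}
    (ha : (a : R) * a ≠ 0)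
    (hmul : ∀ x y : ZeroDivisor R, (a : R) * x ≠ 0 → (a : R) * y = 0 → (x : R) * y = 0)
    (hcard : #{x : ZeroDivisor R | (a : R) * x = 0} < #{x : ZeroDivisor R | (a : R) * x ≠ 0}) :
    HasEqualConnectivities (zeroDivisorGraph R) := by
  have hadd :=
    card_filter_add_card_filter_not (s := univ) fun x : ZeroDivisor R => (a : R) * x = 0
  set S : Finset (ZeroDivisor R) := {x | (a : R) * x = 0}
  obtain ⟨b, hab⟩ := exists_zeroDivisor_mul_eq_zero a
  have hSpos : 0 < #S := card_pos.2 ⟨b, by simpa [S]⟩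
  obtain ⟨w, hw, hwa⟩ := exists_mem_ne (lt_of_le_of_lt hSpos hcard) a
  refine hasEqualConnectivities_of_join (S := S) ?_ (by rw [card_univ] at hadd; lia)
    fun x hx y hy => ⟨fun h => hx (h ▸ hy),
      hmul x y (by simpa [S] using hx) (by simpa [S] using hy)⟩
  exact not_preconnected_induce_of_isolated (v := a) (w := w) (by simpa [S]) (by simpa [S] using hw)
    hwa.symm fun u hu => by simpa [S] using hu.2

open Classical in
theorem card_mul_eq_zero_lt_card_mul_ne_zero {a : ZeroDivisor R}
    (hmul : ∀ x y : ZeroDivisor R, (a : R) * y = 0 → (x : R) * y = 0) (ha : (a : R) * a ≠ 0) :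
    #{x : ZeroDivisor R | (a : R) * x = 0} < #{x : ZeroDivisor R | (a : R) * x ≠ 0} := by
  set S : Finset (ZeroDivisor R) := {x | (a : R) * x = 0}
  set T : Finset (ZeroDivisor R) := {x | (a : R) * x ≠ 0}
  let val : ZeroDivisor R ↪ R := .subtype _
  -- Translation by `a` maps the annihilator of `a` into its complement and misses `a` itself.
  have hsub : (S.map val).map (addLeftEmbedding (a : R)) ⊆ (T.map val).erase a := by
    simp only [subset_iff, mem_map, forall_exists_index, and_imp, forall_apply_eq_imp_iff₂]
    intro y hy
    have hay : (a : R) * y = 0 := by simpa [S] using hy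
    have hne : (a : R) * (a + y) ≠ 0 := by rwa [mul_add, hay, add_zero]
    obtain ⟨z, haz⟩ := exists_zeroDivisor_mul_eq_zero a
    have hz : (a + y : R) * z = 0 := by rw [add_mul, haz, hmul y z haz, add_zero]
    exact mem_erase.2 ⟨by simpa [val] using y.2.1,
      mem_map.2 ⟨⟨a + y, right_ne_zero_of_mul hne, z, z.2.1, hz⟩, by simpa [T] using hne, rfl⟩⟩
  calc #S = #((S.map val).map (addLeftEmbedding (a : R))) := by simp only [card_map]
    _ ≤ #((T.map val).erase a) := card_le_card hsub
    _ < #(T.map val) := card_erase_lt_of_mem (mem_map.2 ⟨a, by simpa [T], rfl⟩)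
    _ = #T := card_map val

theorem hasEqualConnectivities_zeroDivisorGraph_iff_of_forall_dvd {a : ZeroDivisor R}
    (ha : ∀ x : ZeroDivisor R, (a : R) ∣ x) :
    HasEqualConnectivities (zeroDivisorGraph R) ↔ (a : R) * a ≠ 0 := by
  classical
  have hmul : ∀ x y : ZeroDivisor R, (a : R) * y = 0 → (x : R) * y = 0 := fun x y hy => by
    obtain ⟨c, hc⟩ := ha x
    rw [hc, mul_right_comm, hy, zero_mul]
  refine ⟨fun h ha2 => ?_, fun ha2 => hasEqualConnectivities_zeroDivisorGraph_of_card_lt ha2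
    (fun x y _ => hmul x y) (card_mul_eq_zero_lt_card_mul_ne_zero hmul ha2)⟩
  · have htop : zeroDivisorGraph R = ⊤ := zeroDivisorGraph_eq_top fun x y => hmul x y <| by
      rw [mul_comm]
      exact hmul y a ha2
    exact not_hasEqualConnectivities_top (htop ▸ h)

open Classical in
theorem natCard_mul_eq_zero (a : ZeroDivisor R) :
    Nat.card {x : R // (a : R) * x = 0} = #{x : ZeroDivisor R | (a : R) * x = 0} + 1 := by
  let S : Finset (ZeroDivisor R) := {x | (a : R) * x = 0}
  have h0 : (0 : R) ∉ S.map (.subtype _) := by simp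
  rw [← card_map (.subtype _), ← card_insert_of_notMem h0]
  refine Nat.subtype_card _ fun x => ?_
  rcases eq_or_ne x 0 with rfl | hx
  · simp
  · simpa [S, hx] using fun hax => ⟨a, a.2.1, by rwa [mul_comm]⟩

theorem hasEqualConnectivities_zeroDivisorGraph_of_isCoprime {a b : ZeroDivisor R}
    (hab : IsCoprime (a : R) b) (hmul : (a : R) * b = 0)
    (hann : ∀ x : ZeroDivisor R, (a : R) * x = 0 ∨ (b : R) * x = 0)
    (hcard : Nat.card {x : R // (a : R) * x = 0} < Nat.card {x : R // (b : R) * x = 0}) :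
    HasEqualConnectivities (zeroDivisorGraph R) := by
  classical
  refine hasEqualConnectivities_zeroDivisorGraph_of_card_lt (a := a)
    (fun ha2 => a.2.1 (eq_zero_of_isCoprime_of_mul_eq_zero hab ha2 (by rwa [mul_comm])))
    (fun x y hx hy => ?_) ?_
  · have hbx := (hann x).resolve_left hx
    refine eq_zero_of_isCoprime_of_mul_eq_zero hab ?_ ?_
    · rw [mul_left_comm, hy, mul_zero]
    · rw [← mul_assoc, hbx, zero_mul]
  · have hsub : ∀ x : ZeroDivisor R, (b : R) * x = 0 → (a : R) * x ≠ 0 := fun x hbx hax =>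
      x.2.1 (eq_zero_of_isCoprime_of_mul_eq_zero hab hax hbx)
    rw [natCard_mul_eq_zero, natCard_mul_eq_zero, add_lt_add_iff_right] at hcard
    exact hcard.trans_le (card_le_card (monotone_filter_right _ fun x _ => hsub x))

end ZeroDivisorGraph

section ZMod

variable {n : ℕ}

theorem natCast_mul_natCast_eq_zero_iff {p q : ℕ} (hpq : p.Coprime q) (hp : p ∣ n) (hq : q ∣ n) :
    (p : ZMod n) * q = 0 ↔ n = p * q := by
  rw [← Nat.cast_mul, ZMod.natCast_eq_zero_iff]
  exact ⟨fun h => h.antisymm (hpq.mul_dvd_of_dvd_of_dvd hp hq), fun h => h.dvd⟩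

variable [NeZero n]

theorem exists_prime_ne_prime_dvd_or_eq_prime_pow (hn : n ≠ 1) :
    (∃ p q : ℕ, p.Prime ∧ q.Prime ∧ p ≠ q ∧ p ∣ n ∧ q ∣ n) ∨ ∃ p t : ℕ, p.Prime ∧ n = p ^ t := by
  have hp := Nat.minFac_prime hn
  by_cases h : ∃ q, q.Prime ∧ q ∣ n ∧ n.minFac ≠ q
  · obtain ⟨q, hq, hqn, hne⟩ := h
    exact .inl ⟨_, q, hp, hq, hne, n.minFac_dvd, hqn⟩
  · push Not at h
    exact .inr ⟨_, _, hp, Nat.eq_prime_pow_of_unique_prime_dvd (NeZero.ne n)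
      fun hq hqn => (h _ hq hqn).symm⟩

theorem exists_prime_natCast_dvd_zeroDivisor (x : ZeroDivisor (ZMod n)) :
    ∃ r : ℕ, r.Prime ∧ r ∣ n ∧ (r : ZMod n) ∣ x := by
  have hx : ¬ (x : ZMod n).val.Coprime n := fun hcop => by
    obtain ⟨y, hxy⟩ := exists_zeroDivisor_mul_eq_zero x
    rw [← ZMod.isUnit_iff_coprime, ZMod.natCast_zmod_val] at hcop
    exact y.2.1 (hcop.mul_right_eq_zero.1 hxy)
  obtain ⟨r, hr, hrx, hrn⟩ := Nat.Prime.not_coprime_iff_dvd.1 hx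
  exact ⟨r, hr, hrn, by simpa using Nat.cast_dvd_cast (α := ZMod n) hrx⟩

theorem natCast_ne_zero_and_exists_mul_eq_zero {d : ℕ} (hd : d ∣ n) (hd1 : d ≠ 1) (hdn : d ≠ n) :
    (d : ZMod n) ≠ 0 ∧ ∃ y : ZMod n, y ≠ 0 ∧ d * y = 0 := by
  obtain ⟨e, rfl⟩ := hd
  have hmul : (d : ZMod (d * e)) * e = 0 := by simp [← Nat.cast_mul]
  refine ⟨fun h => hdn ?_, e, fun h => hd1 ?_, hmul⟩
  · exact (dvd_mul_right d e).antisymm ((ZMod.natCast_eq_zero_iff _ _).1 h)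
  · exact (mul_eq_right₀ (right_ne_zero_of_mul (NeZero.ne (d * e)))).1
      (((ZMod.natCast_eq_zero_iff _ _).1 h).antisymm (dvd_mul_left e d))

theorem natCard_zmod_natCast_mul_eq_zero {d : ℕ} (hd : d ∣ n) :
    Nat.card {x : ZMod n // (d : ZMod n) * x = 0} = d := by
  have h := IsAddCyclic.card_nsmulAddMonoidHom_ker (ZMod n) d
  rw [Nat.card_zmod, Nat.gcd_eq_right hd] at h
  simpa [AddMonoidHom.mem_ker] using h

theorem hasEqualConnectivities_zeroDivisorGraph_zmod_iff_eq_mul {p q : ℕ} (hp : p.Prime)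
    (hq : q.Prime) (hpq : p ≠ q) (hpn : p ∣ n) (hqn : q ∣ n) :
    HasEqualConnectivities (zeroDivisorGraph (ZMod n)) ↔ n = p * q := by
  wlog hlt : p < q generalizing p q
  · rw [mul_comm]
    exact this hq hp hpq.symm hqn hpn (by lia)
  have hcop : p.Coprime q := (Nat.coprime_primes hp hq).2 hpq
  have hpn' : p ≠ n := fun h => hpq ((Nat.prime_dvd_prime_iff_eq hq hp).1 (h ▸ hqn)).symm
  have hqn' : q ≠ n := fun h => hpq ((Nat.prime_dvd_prime_iff_eq hp hq).1 (h ▸ hpn))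
  let a : ZeroDivisor (ZMod n) := ⟨p,
    natCast_ne_zero_and_exists_mul_eq_zero hpn hp.ne_one hpn'⟩
  let b : ZeroDivisor (ZMod n) := ⟨q,
    natCast_ne_zero_and_exists_mul_eq_zero hqn hq.ne_one hqn'⟩
  have hab : IsCoprime (a : ZMod n) b := hcop.cast
  rw [← natCast_mul_natCast_eq_zero_iff hcop hpn hqn]
  refine ⟨fun h => by_contra fun hmul =>
    not_hasEqualConnectivities_zeroDivisorGraph_of_isCoprime hab hmul h, fun hmul => ?_⟩
  refine hasEqualConnectivities_zeroDivisorGraph_of_isCoprime hab hmul (fun x => ?_) ?_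
  · obtain ⟨r, hr, hrn, c, hc⟩ := exists_prime_natCast_dvd_zeroDivisor x
    rw [(natCast_mul_natCast_eq_zero_iff hcop hpn hqn).1 hmul, hr.dvd_mul,
      Nat.prime_dvd_prime_iff_eq hr hp, Nat.prime_dvd_prime_iff_eq hr hq] at hrn
    rcases hrn with rfl | rfl
    · exact .inr (by rw [hc, ← mul_assoc, mul_comm (b : ZMod n), hmul, zero_mul])
    · exact .inl (by rw [hc, ← mul_assoc, hmul, zero_mul])
  · rwa [natCard_zmod_natCast_mul_eq_zero hpn, natCard_zmod_natCast_mul_eq_zero hqn]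

theorem hasEqualConnectivities_zeroDivisorGraph_zmod_iff_three_le {p t : ℕ} (hp : p.Prime)
    (ht : 2 ≤ t) (hn : n = p ^ t) :
    HasEqualConnectivities (zeroDivisorGraph (ZMod n)) ↔ 3 ≤ t := by
  let a : ZeroDivisor (ZMod n) := ⟨p, natCast_ne_zero_and_exists_mul_eq_zero
    (hn ▸ dvd_pow_self p (by lia)) hp.ne_one (hn ▸ (lt_self_pow₀ hp.one_lt ht).ne)⟩
  have ha : ∀ x : ZeroDivisor (ZMod n), (a : ZMod n) ∣ x := fun x => by
    obtain ⟨r, hr, hrn, hrx⟩ := exists_prime_natCast_dvd_zeroDivisor x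
    rwa [(Nat.prime_dvd_prime_iff_eq hr hp).1 (hr.dvd_of_dvd_pow (hn ▸ hrn))] at hrx
  rw [hasEqualConnectivities_zeroDivisorGraph_iff_of_forall_dvd ha]
  change (p : ZMod n) * p ≠ 0 ↔ _
  rw [← Nat.cast_mul, Ne, ZMod.natCast_eq_zero_iff, ← sq, hn,
    Nat.pow_dvd_pow_iff_le_right hp.one_lt]
  lia

end ZMod

theorem proposition5p6 (n : ℕ) [NeZero n] (hn : 4 ≤ n) (hcomp : ¬ n.Prime) :
    (∃ h : 2 ≤ Fintype.card (ZeroDivisor (ZMod n)),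
        (zeroDivisorGraph (ZMod n)).algebraicConnectivity h =
          ((zeroDivisorGraph (ZMod n)).vertexConnectivity : ℝ)) ↔
      ((∃ p q : ℕ, p.Prime ∧ q.Prime ∧ p ≠ q ∧ n = p * q) ∨
        ∃ p t : ℕ, p.Prime ∧ 3 ≤ t ∧ n = p ^ t) := by
  change HasEqualConnectivities (zeroDivisorGraph (ZMod n)) ↔ _
  constructor
  · intro h
    obtain ⟨p, q, hp, hq, hpq, hpn, hqn⟩ | ⟨p, t, hp, hpow⟩ :=
      exists_prime_ne_prime_dvd_or_eq_prime_pow (by lia : n ≠ 1)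
    · exact .inl ⟨p, q, hp, hq, hpq,
        (hasEqualConnectivities_zeroDivisorGraph_zmod_iff_eq_mul hp hq hpq hpn hqn).1 h⟩
    · have ht : 2 ≤ t := by
        by_contra! hlt
        interval_cases t <;> simp_all
      exact .inr ⟨p, t, hp,
        (hasEqualConnectivities_zeroDivisorGraph_zmod_iff_three_le hp ht hpow).1 h, hpow⟩
  · rintro (⟨p, q, hp, hq, hpq, hmul⟩ | ⟨p, t, hp, ht, hpow⟩)
    · exact (hasEqualConnectivities_zeroDivisorGraph_zmod_iff_eq_mul hp hq hpq
        (hmul ▸ dvd_mul_right p q) (hmul ▸ dvd_mul_left q p)).2 hmul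
    · exact (hasEqualConnectivities_zeroDivisorGraph_zmod_iff_three_le hp (by lia) hpow).2 ht
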